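/- For positive integers $d,n$ let $\otimes^d\mathbb{R}^n$ be the space of real tensors $A=(a_{i_1\dots i_d})_{1\le i_1,\dots,i_d\le n}$, with the Frobenius inner product $\langle A,B\rangle_F=\sum_{i_1,\dots,i_d}a_{i_1\dots i_d}b_{i_1\dots i_d}$ and norm $\|A\|_F=\sqrt{\langle A,A\rangle_F}$. For $x^{(1)},\dots,x^{(d)}\in\mathbb{R}^n$ let $x^{(1)}\otimes\dots\otimes x^{(d)}$ be the tensor with entries $x^{(1)}_{i_1}\cdots x^{(d)}_{i_d}$, and define the spectral norm $$\|A\|_2=\max_{\|x^{(1)}\|=\dots=\|x^{(d)}\|=1}\langle A,x^{(1)}\otimes\dots\otimes x^{(d)}\rangle_F,$$ where $\|\cdot\|$ is the Euclidean norm on $\mathbb{R}^n$. Let $\mathrm{Sym}^d(\mathbb{R}^n)\subset\otimes^d\mathbb{R}^n$ be the subspace of symmetric tensors, i.e. those with $a_{i_{\sigma(1)}\dots i_{\sigma(d)}}=a_{i_1\dots i_d}$ for all indices and every permutation $\sigma$ of $\{1,\dots,d\}$. For $V=\otimes^d\mathbb{R}^n$ or $V=\mathrm{Sym}^d(\mathbb{R}^n)$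 define the best rank-one approximation ratio $$\mathscr{A}(V)=\min_{0\ne A\in V}\frac{\|A\|_2}{\|A\|_F}.$$ Then for every integer $d\ge 3$, $$\mathscr{A}(\otimes^d\mathbb{R}^4)=\frac{1}{\sqrt{4^{d-1}}}<\mathscr{A}(\mathrm{Sym}^d(\mathbb{R}^4))\quad\text{and}\quad\mathscr{A}(\otimes^d\mathbb{R}^8)=\frac{1}{\sqrt{8^{d-1}}}<\mathscr{A}(\mathrm{Sym}^d(\mathbb{R}^8)).$$ -/

import Mathlib

/-- Real tensors of order `d` and size `n × ⋯ × n`, viewed as `d`-dimensional tables of real numbers.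
The inner product of this Euclidean space is the Frobenius inner product `∑ a_{i₁…i_d} b_{i₁…i_d}`,
and its norm is the Frobenius norm. -/
abbrev Tensor (d n : ℕ) : Type := EuclideanSpace ℝ (Fin d → Fin n)

namespace Tensor

/-- The outer product `x⁽¹⁾ ⊗ ⋯ ⊗ x⁽ᵈ⁾`, with entries `x⁽¹⁾_{i₁} ⋯ x⁽ᵈ⁾_{i_d}`. -/
noncomputable def outer {d n : ℕ} (x : Fin d → EuclideanSpace ℝ (Fin n)) : Tensor d n :=
  WithLp.toLp 2 fun i => ∏ j, x j (i j)

/-- The values of `⟨A, x⁽¹⁾ ⊗ ⋯ ⊗ x⁽ᵈ⁾⟩_F` at unit vectors `x⁽¹⁾, …, x⁽ᵈ⁾`. -/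
def unitValues {d n : ℕ} (A : Tensor d n) : Set ℝ :=
  {t | ∃ x : Fin d → EuclideanSpace ℝ (Fin n), (∀ j, ‖x j‖ = 1) ∧ inner ℝ A (outer x) = t}

/-- The spectral norm: the maximum of `⟨A, x⁽¹⁾ ⊗ ⋯ ⊗ x⁽ᵈ⁾⟩_F` over unit vectors
(attained, see `isGreatest_spectralNorm`). -/
noncomputable def spectralNorm {d n : ℕ} (A : Tensor d n) : ℝ := sSup (unitValues A)

/-- The space `Sym^d(ℝⁿ)` of symmetric tensors. -/
def symmetric (d n : ℕ) : Submodule ℝ (Tensor d n) where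
  carrier := {A | ∀ (σ : Equiv.Perm (Fin d)) (i : Fin d → Fin n), A (fun j => i (σ j)) = A i}
  add_mem' hA hB σ i := by simp [hA σ i, hB σ i]
  zero_mem' _ _ := by simp
  smul_mem' c A hA σ i := by simp [hA σ i]

/-- The ratios of spectral norm and Frobenius norm of the nonzero tensors in a space `V`. -/
def normRatios {d n : ℕ} (V : Submodule ℝ (Tensor d n)) : Set ℝ :=
  {r | ∃ A ∈ V, A ≠ 0 ∧ spectralNorm A / ‖A‖ = r}

/-- The best rank-one approximation ratio of a space `V` of tensors: the minimum of
`‖A‖₂ / ‖A‖_F` over the nonzero `A ∈ V` (attained, see `isLeast_bestRankOneRatio`). -/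
noncomputable def bestRankOneRatio {d n : ℕ} (V : Submodule ℝ (Tensor d n)) : ℝ :=
  sInf (normRatios V)

/-! The maximum and the minimum in the definitions above are attained. -/

theorem continuous_inner_outer (d n : ℕ) :
    Continuous fun p : Tensor d n × (Fin d → EuclideanSpace ℝ (Fin n)) =>
      inner ℝ p.1 (outer p.2) := by
  unfold outer
  fun_prop

theorem isCompact_unitVectors (d n : ℕ) :
    IsCompact {x : Fin d → EuclideanSpace ℝ (Fin n) | ∀ j, ‖x j‖ = 1} := by
  have h := isCompact_univ_pi (fun _ : Fin d => isCompact_sphere (0 : EuclideanSpace ℝ (Fin n)) 1)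
  convert h using 1
  ext x
  simp

theorem isGreatest_spectralNorm {d n : ℕ} (hn : 1 ≤ n) (A : Tensor d n) :
    IsGreatest (unitValues A) (spectralNorm A) := by
  have hc : IsCompact (unitValues A) :=
    (isCompact_unitVectors d n).image
      ((continuous_inner_outer d n).comp (Continuous.prodMk_right A))
  refine hc.isGreatest_sSup
    ⟨_, fun _ => EuclideanSpace.single (⟨0, hn⟩ : Fin n) (1 : ℝ), fun _ => by simp, rfl⟩

theorem continuous_spectralNorm (d n : ℕ) :
    Continuous (spectralNorm : Tensor d n → ℝ) :=
  (isCompact_unitVectors d n).continuous_sSup (continuous_inner_outer d n)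

open scoped Pointwise in
theorem spectralNorm_smul {d n : ℕ} {c : ℝ} (hc : 0 ≤ c) (A : Tensor d n) :
    spectralNorm (c • A) = c * spectralNorm A := by
  have h : unitValues (c • A) = c • unitValues A := by
    ext t
    simp only [unitValues, Set.mem_smul_set, Set.mem_ofPred_eq, inner_smul_left]
    constructor
    · rintro ⟨x, hx, rfl⟩
      exact ⟨_, ⟨x, hx, rfl⟩, by simp⟩
    · rintro ⟨_, ⟨x, hx, rfl⟩, rfl⟩
      exact ⟨x, hx, by simp⟩
  rw [spectralNorm, h, Real.sSup_smul_of_nonneg hc, smul_eq_mul, spectralNorm]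

theorem isLeast_bestRankOneRatio {d n : ℕ} {V : Submodule ℝ (Tensor d n)} (hV : V ≠ ⊥) :
    IsLeast (normRatios V) (bestRankOneRatio V) := by
  have hS : IsCompact (Metric.sphere (0 : Tensor d n) 1 ∩ (V : Set (Tensor d n))) :=
    (isCompact_sphere _ _).inter_right V.closed_of_finiteDimensional
  have himg : normRatios V =
      spectralNorm '' (Metric.sphere (0 : Tensor d n) 1 ∩ (V : Set (Tensor d n))) := by
    ext r
    constructor
    · rintro ⟨A, hA, h0, rfl⟩
      refine ⟨‖A‖⁻¹ • A, ⟨?_, V.smul_mem _ hA⟩, ?_⟩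
      · simp [norm_smul, h0]
      · rw [spectralNorm_smul (by positivity)]
        ring
    · rintro ⟨A, ⟨h1, hA⟩, rfl⟩
      have h1' : ‖A‖ = 1 := by simpa using h1
      refine ⟨A, hA, ?_, by simp [h1']⟩
      rintro rfl
      simp at h1'
  obtain ⟨A, hA, h0⟩ := V.ne_bot_iff.1 hV
  have hne : (normRatios V).Nonempty := ⟨_, A, hA, h0, rfl⟩
  have hc : IsCompact (normRatios V) := himg ▸ hS.image (continuous_spectralNorm d n)
  exact hc.isLeast_sInf hne

/-- There are nonzero symmetric tensors as soon as `n ≥ 1`. -/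
theorem symmetric_ne_bot {d n : ℕ} (hn : 1 ≤ n) : symmetric d n ≠ ⊥ := by
  rw [Submodule.ne_bot_iff]
  refine ⟨WithLp.toLp 2 fun _ => 1, fun _ _ => rfl, fun h => ?_⟩
  have := congrArg (fun A : Tensor d n => A fun _ => ⟨0, hn⟩) h
  simp at this

end Tensor

namespace Tensor

/-! An order-`d` tensor has `n` slices along its first mode. Their squared norms add up to `‖A‖ ^
2`, and none has larger spectral norm than `A`. Induction from order one gives `‖A‖ ^ 2 ≤ n ^ (d -
1) * spectralNorm A ^ 2` (`norm_sq_le`), and equality passes to every slice. For `n = 4, 8` the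
bound is attained by iterated quaternion or octonion products, as these preserve norms
(`bestRankOneRatio_top_eq`); associativity plays no role.

A symmetric case of equality can be sliced down to order three, where it is a commutative product
with `‖B x y‖ ≤ S ‖x‖ ‖y‖` and equality on basis pairs. Such a product has `B eᵢ eᵢ = -B eⱼ eⱼ` for
`i ≠ j`, which for three indices forces `S = 0` (`eq_zero_of_bilinear`). -/

/-- The contraction of a tensor with a vector along its first mode. -/
noncomputable def contract {d n : ℕ} :
    Tensor (d + 1) n →ₗ[ℝ] EuclideanSpace ℝ (Fin n) →ₗ[ℝ] Tensor d n :=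
  LinearMap.mk₂ ℝ (fun A x => WithLp.toLp 2 fun i => ∑ k, A (Fin.cons k i) * x k)
    (fun A B x => by ext i; simp [add_mul, Finset.sum_add_distrib])
    (fun c A x => by ext i; simp [Finset.mul_sum, mul_assoc])
    (fun A x y => by ext i; simp [mul_add, Finset.sum_add_distrib])
    (fun c A x => by ext i; simp [Finset.mul_sum, mul_left_comm])

theorem contract_apply {d n : ℕ} (A : Tensor (d + 1) n) (x : EuclideanSpace ℝ (Fin n))
    (i : Fin d → Fin n) : contract A x i = ∑ k, A (Fin.cons k i) * x k := rfl

theorem contract_single {d n : ℕ} (A : Tensor (d + 1) n) (k : Fin n) (i : Fin d → Fin n) :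
    contract A (EuclideanSpace.single k 1) i = A (Fin.cons k i) := by
  simp [contract_apply]

theorem sum_cons {d n : ℕ} (f : (Fin (d + 1) → Fin n) → ℝ) :
    ∑ i, f i = ∑ k, ∑ i : Fin d → Fin n, f (Fin.cons k i) := by
  rw [← Fintype.sum_prod_type' fun k i => f (Fin.cons k i)]
  exact ((Fin.consEquiv fun _ => Fin n).sum_comp f).symm

theorem inner_outer {d n : ℕ} (A : Tensor d n) (x : Fin d → EuclideanSpace ℝ (Fin n)) :
    inner ℝ A (outer x) = ∑ i, A i * ∏ j, x j (i j) := by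
  simp [outer, PiLp.inner_apply, mul_comm]

theorem inner_outer_succ {d n : ℕ} (A : Tensor (d + 1) n)
    (x : Fin (d + 1) → EuclideanSpace ℝ (Fin n)) :
    inner ℝ A (outer x) = inner ℝ (contract A (x 0)) (outer (Fin.tail x)) := by
  simp only [inner_outer, sum_cons, contract_apply, Finset.sum_mul]
  rw [Finset.sum_comm]
  simp [Fin.prod_univ_succ, Fin.tail, mul_assoc]

theorem norm_sq_eq_sum_contract {d n : ℕ} (A : Tensor (d + 1) n) :
    ‖A‖ ^ 2 = ∑ k, ‖contract A (EuclideanSpace.single k 1)‖ ^ 2 := by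
  simp only [EuclideanSpace.norm_sq_eq, contract_single]
  exact sum_cons _

theorem inner_outer_le {d n : ℕ} (hn : 1 ≤ n) (A : Tensor d n)
    (x : Fin d → EuclideanSpace ℝ (Fin n)) (hx : ∀ j, ‖x j‖ = 1) :
    inner ℝ A (outer x) ≤ spectralNorm A :=
  (isGreatest_spectralNorm hn A).2 ⟨x, hx, rfl⟩

theorem spectralNorm_contract_le {d n : ℕ} (hn : 1 ≤ n) (A : Tensor (d + 1) n)
    (x : EuclideanSpace ℝ (Fin n)) (hx : ‖x‖ = 1) :
    spectralNorm (contract A x) ≤ spectralNorm A := by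
  obtain ⟨y, hy, h⟩ := (isGreatest_spectralNorm hn (contract A x)).1
  rw [← h]
  have := inner_outer_le hn A (Fin.cons x y) (Fin.cases hx hy)
  rwa [inner_outer_succ, Fin.cons_zero, Fin.tail_cons] at this

theorem norm_le_spectralNorm {n : ℕ} (hn : 1 ≤ n) (A : Tensor 1 n) : ‖A‖ ≤ spectralNorm A := by
  have hsum (f : (Fin 1 → Fin n) → ℝ) : ∑ i, f i = ∑ k, f fun _ => k :=
    ((Equiv.funUnique (Fin 1) (Fin n)).symm.sum_comp f).symm
  by_cases hA : A = 0
  · have h := inner_outer_le hn A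
      (fun _ => EuclideanSpace.single (⟨0, hn⟩ : Fin n) (1 : ℝ)) fun _ => by simp
    simpa [hA] using h
  · have hA' : 0 < ‖A‖ := norm_pos_iff.2 hA
    have hsq : ‖A‖ ^ 2 = ∑ k, (A fun _ => k) ^ 2 := by
      simp [EuclideanSpace.norm_sq_eq, hsum]
    -- At order one the tensor is a vector, and its own normalization is the optimal test vector.
    have h := inner_outer_le hn A (fun _ => ‖A‖⁻¹ • WithLp.toLp 2 fun k => A fun _ => k) fun _ => by
      have : ‖WithLp.toLp 2 fun k => A fun _ => k‖ = ‖A‖ := by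
        rw [← sq_eq_sq₀ (norm_nonneg _) (norm_nonneg _), hsq]
        simp [EuclideanSpace.norm_sq_eq]
      rw [norm_smul, this, norm_inv, norm_norm, inv_mul_cancel₀ hA'.ne']
    refine le_of_eq_of_le ?_ h
    rw [inner_outer, hsum]
    simp only [Finset.univ_unique, Finset.prod_singleton, PiLp.smul_apply, smul_eq_mul]
    have : ∀ k, (A fun _ => k) * (‖A‖⁻¹ * A fun _ => k) = ‖A‖⁻¹ * (A fun _ => k) ^ 2 :=
      fun k => by ring
    simp only [this, ← Finset.mul_sum, ← hsq]
    field_simp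

/-- Order zero is excluded: there the spectral norm is the signed scalar itself. -/
theorem spectralNorm_nonneg {d n : ℕ} (hn : 1 ≤ n) (A : Tensor (d + 1) n) :
    0 ≤ spectralNorm A := by
  induction d with
  | zero => exact (norm_nonneg A).trans (norm_le_spectralNorm hn A)
  | succ d ih =>
    exact (ih _).trans (spectralNorm_contract_le hn A
      (EuclideanSpace.single (⟨0, hn⟩ : Fin n) (1 : ℝ)) (by simp))

/-! ### The slicing bound and its equality case -/

theorem norm_sq_le {d n : ℕ} (hn : 1 ≤ n) (A : Tensor (d + 1) n) :
    ‖A‖ ^ 2 ≤ n ^ d * spectralNorm A ^ 2 := by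
  induction d with
  | zero =>
    simpa using pow_le_pow_left₀ (norm_nonneg A) (norm_le_spectralNorm hn A) 2
  | succ d ih =>
    rw [norm_sq_eq_sum_contract]
    calc _ ≤ ∑ _k : Fin n, (n : ℝ) ^ d * spectralNorm A ^ 2 := by
          refine Finset.sum_le_sum fun k _ => (ih _).trans ?_
          gcongr
          · exact spectralNorm_nonneg hn _
          · exact spectralNorm_contract_le hn A _ (by simp)
      _ = _ := by simp; ring

/-- In the case of equality in `norm_sq_le`, all slices are cases of equality, with the same
spectral norm. -/
theorem contract_single_of_norm_sq_eq {d n : ℕ} (hn : 1 ≤ n) {A : Tensor (d + 2) n}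
    (hA : ‖A‖ ^ 2 = n ^ (d + 1) * spectralNorm A ^ 2) (k : Fin n) :
    spectralNorm (contract A (EuclideanSpace.single k 1)) = spectralNorm A ∧
      ‖contract A (EuclideanSpace.single k 1)‖ ^ 2 = n ^ d * spectralNorm A ^ 2 := by
  have hn' : (0 : ℝ) < n ^ d := by positivity
  have hS k := spectralNorm_contract_le hn A (EuclideanSpace.single k (1 : ℝ)) (by simp)
  have h0 k := spectralNorm_nonneg hn (contract A (EuclideanSpace.single k (1 : ℝ)))
  have hle k : ‖contract A (EuclideanSpace.single k 1)‖ ^ 2 ≤ n ^ d * spectralNorm A ^ 2 :=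
    (norm_sq_le hn _).trans (by gcongr; exacts [h0 k, hS k])
  have hsum : ∑ k, ‖contract A (EuclideanSpace.single k 1)‖ ^ 2 =
      ∑ _k : Fin n, (n : ℝ) ^ d * spectralNorm A ^ 2 := by
    rw [← norm_sq_eq_sum_contract, hA]
    simp
    ring
  have heq := (Finset.sum_eq_sum_iff_of_le fun k _ => hle k).1 hsum k (Finset.mem_univ k)
  refine ⟨(hS k).antisymm ?_, heq⟩
  -- The bound for the slice, whose norm is now known, gives the reverse inequality of spectral
  -- norms.
  have h := norm_sq_le hn (contract A (EuclideanSpace.single k (1 : ℝ)))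
  rw [heq] at h
  exact le_of_sq_le_sq (le_of_mul_le_mul_left h hn') (h0 k)

theorem norm_contract_contract_le {n : ℕ} (hn : 1 ≤ n) (A : Tensor 3 n)
    (x y : EuclideanSpace ℝ (Fin n)) :
    ‖contract (contract A x) y‖ ≤ spectralNorm A * ‖x‖ * ‖y‖ := by
  by_cases hx : x = 0
  · simp [hx]
  by_cases hy : y = 0
  · simp [hy]
  have hx' := norm_pos_iff.2 hx
  have hy' := norm_pos_iff.2 hy
  have h := (norm_le_spectralNorm hn _).trans <|
    (spectralNorm_contract_le hn (contract A (‖x‖⁻¹ • x)) (‖y‖⁻¹ • y)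
      (norm_smul_inv_norm hy)).trans <|
    spectralNorm_contract_le hn A (‖x‖⁻¹ • x) (norm_smul_inv_norm hx)
  simp only [map_smul, LinearMap.smul_apply, norm_smul, norm_inv, norm_norm] at h
  rw [mul_assoc]
  rw [inv_mul_le_iff₀ hy', inv_mul_le_iff₀ hx'] at h
  linarith

/-! ### Symmetric tensors are never extremal -/

theorem contract_contract_comm {d n : ℕ} {A : Tensor (d + 2) n} (hA : A ∈ symmetric (d + 2) n)
    (x y : EuclideanSpace ℝ (Fin n)) :
    contract (contract A x) y = contract (contract A y) x := by
  ext i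
  simp only [contract_apply, Finset.sum_mul]
  rw [Finset.sum_comm]
  refine Finset.sum_congr rfl fun j _ => Finset.sum_congr rfl fun k _ => ?_
  have h : A (Fin.cons j (Fin.cons k i)) = A (Fin.cons k (Fin.cons j i)) := by
    rw [← hA (Equiv.swap 0 1)]
    refine congrArg A (funext fun l => ?_)
    refine Fin.cases ?_ (Fin.cases ?_ fun l => ?_) l
    · simp
    · simp
    · rw [Equiv.swap_apply_of_ne_of_ne (Fin.succ_ne_zero _)
        (fun h => Fin.succ_ne_zero l <|
          Fin.succ_injective _ (h.trans Fin.succ_zero_eq_one.symm))]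
      simp
  rw [h]
  ring

theorem contract_single_mem_symmetric {d n : ℕ} {A : Tensor (d + 1) n}
    (hA : A ∈ symmetric (d + 1) n) (k : Fin n) :
    contract A (EuclideanSpace.single k 1) ∈ symmetric d n := by
  intro σ i
  -- This permutation fixes `0` and acts as `σ` on the successors.
  rw [contract_single, contract_single, ← hA (Equiv.Perm.decomposeFin.symm (0, σ)) (Fin.cons k i)]
  refine congrArg A (funext fun l => ?_)
  refine Fin.cases ?_ (fun l => ?_) l <;> simp

/-- A symmetric bilinear map that satisfies `‖B x y‖ ≤ S ‖x‖ ‖y‖`, with equality at all pairs from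
three orthonormal vectors, vanishes on them. -/
theorem eq_zero_of_bilinear {E F : Type*} [NormedAddCommGroup E] [InnerProductSpace ℝ E]
    [NormedAddCommGroup F] [InnerProductSpace ℝ F] (B : E →ₗ[ℝ] E →ₗ[ℝ] F)
    (hB : ∀ x y, B x y = B y x) {S : ℝ} (hS : ∀ x y, ‖B x y‖ ≤ S * ‖x‖ * ‖y‖)
    {e : Fin 3 → E} (he : Orthonormal ℝ e) (heq : ∀ i j, ‖B (e i) (e j)‖ = S) : S = 0 := by
  have hS' x y : ‖B x y‖ ^ 2 ≤ S ^ 2 * ‖x‖ ^ 2 * ‖y‖ ^ 2 := by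
    rw [← mul_pow, ← mul_pow]
    exact pow_le_pow_left₀ (norm_nonneg _) (hS x y) 2
  have hpar {G : Type _} [NormedAddCommGroup G] [InnerProductSpace ℝ G] (u v : G) :
      ‖u + v‖ ^ 2 + ‖u - v‖ ^ 2 = 2 * (‖u‖ ^ 2 + ‖v‖ ^ 2) := by
    have := parallelogram_law_with_norm ℝ u v
    linarith
  have key : ∀ i j, i ≠ j → B (e i) (e i) + B (e j) (e j) = 0 := by
    intro i j hij
    have hadd : ‖e i + e j‖ ^ 2 = 2 := by
      rw [norm_add_sq_real, he.1, he.1, he.2 hij]; norm_num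
    have hsub : ‖e i - e j‖ ^ 2 = 2 := by
      rw [norm_sub_sq_real, he.1, he.1, he.2 hij]; norm_num
    -- By the parallelogram law the squares for `e i ± e j` add up to `4 * S ^ 2`, and each is at
    -- most `2 * S ^ 2`; so both bounds are equalities. The next step repeats this in the second
    -- argument.
    have h1 k : ‖B (e i + e j) (e k)‖ ^ 2 = 2 * S ^ 2 := by
      have h := hpar (B (e i) (e k)) (B (e j) (e k))
      rw [← LinearMap.add_apply, ← LinearMap.sub_apply, ← map_add, ← map_sub, heq, heq] at h
      have h1 := hS' (e i + e j) (e k)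
      have h2 := hS' (e i - e j) (e k)
      rw [hadd, he.1] at h1
      rw [hsub, he.1] at h2
      linarith
    have h2 : ‖B (e i + e j) (e i - e j)‖ ^ 2 = 4 * S ^ 2 := by
      have h := hpar (B (e i + e j) (e i)) (B (e i + e j) (e j))
      rw [← map_add, ← map_sub, h1, h1] at h
      have h2 := hS' (e i + e j) (e i + e j)
      have h3 := hS' (e i + e j) (e i - e j)
      rw [hadd] at h2
      rw [hadd, hsub] at h3
      linarith
    -- Commutativity cancels the cross terms. The difference of the two squares then has the maximal
    -- norm `2 * S`, so the parallelogram law leaves nothing for their sum.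
    have h3 : B (e i + e j) (e i - e j) = B (e i) (e i) - B (e j) (e j) := by
      simp only [map_add, map_sub, LinearMap.add_apply, hB (e j) (e i)]
      abel
    have h := hpar (B (e i) (e i)) (B (e j) (e j))
    rw [← h3, h2, heq, heq] at h
    rw [← norm_eq_zero, ← sq_eq_zero_iff]
    linarith
  have h01 := key 0 1 (by decide)
  have h02 := key 0 2 (by decide)
  have h12 := key 1 2 (by decide)
  have h0 : (2 : ℝ) • B (e 0) (e 0) = 0 := by
    calc _ = (B (e 0) (e 0) + B (e 1) (e 1)) + (B (e 0) (e 0) + B (e 2) (e 2)) -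
          (B (e 1) (e 1) + B (e 2) (e 2)) := by module
      _ = 0 := by rw [h01, h02, h12]; simp
  rw [← heq 0 0, (smul_eq_zero.1 h0).resolve_left two_ne_zero, norm_zero]

theorem eq_zero_of_symmetric {d n : ℕ} (hn : 3 ≤ n) {A : Tensor (d + 3) n}
    (hsym : A ∈ symmetric (d + 3) n) (hA : ‖A‖ ^ 2 = n ^ (d + 2) * spectralNorm A ^ 2) : A = 0 := by
  have hn1 : 1 ≤ n := by omega
  suffices h : spectralNorm A = 0 by
    rw [← norm_eq_zero, ← sq_eq_zero_iff, hA, h]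
    simp
  induction d with
  | zero =>
    refine eq_zero_of_bilinear
      (LinearMap.mk₂ ℝ (fun x y => contract (contract A x) y) (by simp) (by simp) (by simp)
        (by simp))
      (contract_contract_comm hsym) (norm_contract_contract_le hn1 A)
      (e := fun i => EuclideanSpace.single (Fin.castLE hn i) 1) ?_ fun i j => ?_
    · exact (EuclideanSpace.orthonormal_single (ι := Fin n)).comp _ (Fin.castLE_injective hn)
    -- Slicing twice reaches order one, where the factor is `n ^ 0` and equality reads `‖B eᵢ eⱼ‖ =
    -- S`.
    · obtain ⟨h1, h2⟩ := contract_single_of_norm_sq_eq hn1 hA (Fin.castLE hn i)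
      rw [← h1] at h2
      have h3 := (contract_single_of_norm_sq_eq hn1 h2 (Fin.castLE hn j)).2
      rw [h1, pow_zero, one_mul, sq_eq_sq₀ (norm_nonneg _) (spectralNorm_nonneg hn1 A)] at h3
      exact h3
  | succ d ih =>
    obtain ⟨h1, h2⟩ := contract_single_of_norm_sq_eq hn1 hA ⟨0, hn1⟩
    rw [← h1] at h2 ⊢
    exact ih (contract_single_mem_symmetric hsym _) h2

theorem one_div_sqrt_le {d n : ℕ} (hn : 1 ≤ n) {A : Tensor (d + 1) n} (hA : A ≠ 0) :
    1 / √((n : ℝ) ^ d) ≤ spectralNorm A / ‖A‖ := by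
  have hn' : (0 : ℝ) < n ^ d := by positivity
  rw [div_le_div_iff₀ (Real.sqrt_pos.2 hn') (norm_pos_iff.2 hA), one_mul]
  refine le_of_sq_le_sq ?_ (mul_nonneg (spectralNorm_nonneg hn A) (Real.sqrt_nonneg _))
  rw [mul_pow, Real.sq_sqrt hn'.le, mul_comm]
  exact norm_sq_le hn A

/-- Strictness passes to the infimum because it is attained. -/
theorem one_div_sqrt_lt_bestRankOneRatio_symmetric {d n : ℕ} (hn : 3 ≤ n) :
    1 / √((n : ℝ) ^ (d + 2)) < bestRankOneRatio (symmetric (d + 3) n) := by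
  have hn1 : 1 ≤ n := by omega
  obtain ⟨A, hsym, hA, h⟩ := (isLeast_bestRankOneRatio (symmetric_ne_bot (d := d + 3) hn1)).1
  rw [← h]
  refine (one_div_sqrt_le hn1 hA).lt_of_ne fun heq => hA (eq_zero_of_symmetric hn hsym ?_)
  have hn' : (0 : ℝ) < n ^ (d + 2) := by positivity
  rw [div_eq_div_iff (Real.sqrt_pos.2 hn').ne' (norm_ne_zero_iff.2 hA), one_mul] at heq
  rw [heq, mul_pow, Real.sq_sqrt hn'.le, mul_comm]

/-! ### Extremal tensors from composition algebras -/

section Composition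

variable {n : ℕ}
  (mul : EuclideanSpace ℝ (Fin n) →ₗ[ℝ] EuclideanSpace ℝ (Fin n) →ₗ[ℝ] EuclideanSpace ℝ (Fin n))

/-- The tensor of the multilinear form
`(x₀, …, x_d) ↦ ⟨x_{d-1} * (⋯ * (x₁ * (x₀ * z))), x_d⟩` for a bilinear product `*`. -/
noncomputable def ofMul : (d : ℕ) → EuclideanSpace ℝ (Fin n) →ₗ[ℝ] Tensor (d + 1) n
  | 0 =>
    { toFun := fun z => WithLp.toLp 2 fun i => z (i 0)
      map_add' := fun _ _ => rfl
      map_smul' := fun _ _ => rfl }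
  | d + 1 =>
    { toFun := fun z => WithLp.toLp 2 fun i =>
        ofMul d (mul (EuclideanSpace.single (i 0) 1) z) (Fin.tail i)
      map_add' := fun _ _ => by ext i; simp
      map_smul' := fun _ _ => by ext i; simp }

theorem ofMul_zero_apply (z : EuclideanSpace ℝ (Fin n)) (i : Fin 1 → Fin n) :
    ofMul mul 0 z i = z (i 0) := rfl

theorem ofMul_succ_apply (d : ℕ) (z : EuclideanSpace ℝ (Fin n)) (i : Fin (d + 2) → Fin n) :
    ofMul mul (d + 1) z i = ofMul mul d (mul (EuclideanSpace.single (i 0) 1) z) (Fin.tail i) := rfl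

theorem contract_ofMul (d : ℕ) (x z : EuclideanSpace ℝ (Fin n)) :
    contract (ofMul mul (d + 1) z) x = ofMul mul d (mul x z) := by
  have hx : x = ∑ k, x k • EuclideanSpace.single k (1 : ℝ) := by
    ext j
    simp [Pi.single_apply]
  conv_rhs => rw [hx]
  ext i
  simp [contract_apply, ofMul_succ_apply, Fin.tail_cons, mul_comm]

variable {mul}

/-- The slices belong to the `n` vectors `mul eₖ z`, all of norm `‖z‖`. -/
theorem norm_sq_ofMul (hmul : ∀ x y, ‖mul x y‖ = ‖x‖ * ‖y‖) (d : ℕ)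
    (z : EuclideanSpace ℝ (Fin n)) : ‖ofMul mul d z‖ ^ 2 = n ^ d * ‖z‖ ^ 2 := by
  induction d generalizing z with
  | zero =>
    simp only [EuclideanSpace.norm_sq_eq, ofMul_zero_apply, pow_zero, one_mul]
    exact (Equiv.funUnique (Fin 1) (Fin n)).sum_comp fun k => ‖z k‖ ^ 2
  | succ d ih =>
    simp [norm_sq_eq_sum_contract, contract_ofMul, ih, hmul]
    ring

/-- Contracting with a unit vector keeps the norm of `z`; Cauchy–Schwarz ends the induction. -/
theorem inner_ofMul_outer_le (hmul : ∀ x y, ‖mul x y‖ = ‖x‖ * ‖y‖) (d : ℕ)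
    (z : EuclideanSpace ℝ (Fin n)) (x : Fin (d + 1) → EuclideanSpace ℝ (Fin n))
    (hx : ∀ j, ‖x j‖ = 1) : inner ℝ (ofMul mul d z) (outer x) ≤ ‖z‖ := by
  induction d generalizing z with
  | zero =>
    have h : inner ℝ (ofMul mul 0 z) (outer x) = inner ℝ z (x 0) := by
      rw [inner_outer, PiLp.inner_apply]
      simp only [ofMul_zero_apply, Fin.prod_univ_succ, Fin.prod_univ_zero, mul_one]
      refine ((Equiv.funUnique (Fin 1) (Fin n)).sum_comp fun k => z k * x 0 k).trans ?_
      simp [mul_comm]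
    rw [h]
    simpa [hx] using real_inner_le_norm z (x 0)
  | succ d ih =>
    rw [inner_outer_succ, contract_ofMul]
    simpa [hmul, hx] using ih (mul (x 0) z) (Fin.tail x) fun j => hx j.succ

theorem bestRankOneRatio_top_eq (hn : 1 ≤ n) (hmul : ∀ x y, ‖mul x y‖ = ‖x‖ * ‖y‖) (d : ℕ) :
    bestRankOneRatio (⊤ : Submodule ℝ (Tensor (d + 1) n)) = 1 / √((n : ℝ) ^ d) := by
  have hn' : (0 : ℝ) < n ^ d := by positivity
  set z : EuclideanSpace ℝ (Fin n) := EuclideanSpace.single ⟨0, hn⟩ 1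
  have hz : ‖z‖ = 1 := by simp [z]
  have hnorm : ‖ofMul mul d z‖ = √((n : ℝ) ^ d) := by
    rw [eq_comm, Real.sqrt_eq_iff_eq_sq hn'.le (norm_nonneg _), norm_sq_ofMul hmul, hz]
    simp
  have h0 : ofMul mul d z ≠ 0 := by
    rw [← norm_pos_iff, hnorm]
    exact Real.sqrt_pos.2 hn'
  have hleast := isLeast_bestRankOneRatio ((Submodule.ne_bot_iff _).2 ⟨_, Submodule.mem_top, h0⟩)
  apply le_antisymm
  · refine (hleast.2 ⟨_, Submodule.mem_top, h0, rfl⟩).trans ?_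
    rw [hnorm]
    gcongr
    obtain ⟨x, hx, h⟩ := (isGreatest_spectralNorm hn (ofMul mul d z)).1
    rw [← h, ← hz]
    exact inner_ofMul_outer_le hmul d z x hx
  · obtain ⟨A, -, hA, h⟩ := hleast.1
    rw [← h]
    exact one_div_sqrt_le hn hA

end Composition

/-- Quaternion multiplication on `ℝ⁴`. -/
noncomputable def mulFour : EuclideanSpace ℝ (Fin 4) →ₗ[ℝ] EuclideanSpace ℝ (Fin 4) →ₗ[ℝ]
    EuclideanSpace ℝ (Fin 4) :=
  LinearMap.mk₂ ℝ
    (fun x y => !₂[x 0 * y 0 - x 1 * y 1 - x 2 * y 2 - x 3 * y 3,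
      x 0 * y 1 + x 1 * y 0 + x 2 * y 3 - x 3 * y 2,
      x 0 * y 2 - x 1 * y 3 + x 2 * y 0 + x 3 * y 1,
      x 0 * y 3 + x 1 * y 2 - x 2 * y 1 + x 3 * y 0])
    (fun x y z => by ext i; fin_cases i <;> simp <;> ring)
    (fun c x y => by ext i; fin_cases i <;> simp <;> ring)
    (fun x y z => by ext i; fin_cases i <;> simp <;> ring)
    (fun c x y => by ext i; fin_cases i <;> simp <;> ring)

/-- Euler's four-square identity. -/
theorem norm_mulFour (x y : EuclideanSpace ℝ (Fin 4)) : ‖mulFour x y‖ = ‖x‖ * ‖y‖ := by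
  rw [← sq_eq_sq₀ (norm_nonneg _) (by positivity), mul_pow]
  simp [EuclideanSpace.norm_sq_eq, Fin.sum_univ_four, mulFour]
  ring

/-- Octonion multiplication on `ℝ⁸`. -/
noncomputable def mulEight : EuclideanSpace ℝ (Fin 8) →ₗ[ℝ] EuclideanSpace ℝ (Fin 8) →ₗ[ℝ]
    EuclideanSpace ℝ (Fin 8) :=
  LinearMap.mk₂ ℝ
    (fun x y => !₂[x 0 * y 0 - x 1 * y 1 - x 2 * y 2 - x 3 * y 3
        - x 4 * y 4 - x 5 * y 5 - x 6 * y 6 - x 7 * y 7,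
      x 0 * y 1 + x 1 * y 0 + x 2 * y 3 - x 3 * y 2
        + x 4 * y 5 - x 5 * y 4 - x 6 * y 7 + x 7 * y 6,
      x 0 * y 2 - x 1 * y 3 + x 2 * y 0 + x 3 * y 1
        + x 4 * y 6 + x 5 * y 7 - x 6 * y 4 - x 7 * y 5,
      x 0 * y 3 + x 1 * y 2 - x 2 * y 1 + x 3 * y 0
        + x 4 * y 7 - x 5 * y 6 + x 6 * y 5 - x 7 * y 4,
      x 0 * y 4 - x 1 * y 5 - x 2 * y 6 - x 3 * y 7
        + x 4 * y 0 + x 5 * y 1 + x 6 * y 2 + x 7 * y 3,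
      x 0 * y 5 + x 1 * y 4 - x 2 * y 7 + x 3 * y 6
        - x 4 * y 1 + x 5 * y 0 - x 6 * y 3 + x 7 * y 2,
      x 0 * y 6 + x 1 * y 7 + x 2 * y 4 - x 3 * y 5
        - x 4 * y 2 + x 5 * y 3 + x 6 * y 0 - x 7 * y 1,
      x 0 * y 7 - x 1 * y 6 + x 2 * y 5 + x 3 * y 4
        - x 4 * y 3 - x 5 * y 2 + x 6 * y 1 + x 7 * y 0])
    (fun x y z => by ext i; fin_cases i <;> simp <;> ring)
    (fun c x y => by ext i; fin_cases i <;> simp <;> ring)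
    (fun x y z => by ext i; fin_cases i <;> simp <;> ring)
    (fun c x y => by ext i; fin_cases i <;> simp <;> ring)

/-- Degen's eight-square identity. -/
theorem norm_mulEight (x y : EuclideanSpace ℝ (Fin 8)) : ‖mulEight x y‖ = ‖x‖ * ‖y‖ := by
  rw [← sq_eq_sq₀ (norm_nonneg _) (by positivity), mul_pow]
  simp [EuclideanSpace.norm_sq_eq, Fin.sum_univ_eight, mulEight]
  ring

end Tensor

theorem mainTheorem9 (d : ℕ) (hd : 3 ≤ d) :
    (Tensor.bestRankOneRatio (⊤ : Submodule ℝ (Tensor d 4)) = 1 / Real.sqrt ((4 : ℝ) ^ (d - 1)) ∧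
      1 / Real.sqrt ((4 : ℝ) ^ (d - 1)) < Tensor.bestRankOneRatio (Tensor.symmetric d 4)) ∧
    (Tensor.bestRankOneRatio (⊤ : Submodule ℝ (Tensor d 8)) = 1 / Real.sqrt ((8 : ℝ) ^ (d - 1)) ∧
      1 / Real.sqrt ((8 : ℝ) ^ (d - 1)) < Tensor.bestRankOneRatio (Tensor.symmetric d 8)) := by
  obtain ⟨d, rfl⟩ := Nat.exists_eq_add_of_le' hd
  exact ⟨⟨Tensor.bestRankOneRatio_top_eq (by norm_num) Tensor.norm_mulFour (d + 2),
      Tensor.one_div_sqrt_lt_bestRankOneRatio_symmetric (n := 4) (by norm_num)⟩,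
    Tensor.bestRankOneRatio_top_eq (by norm_num) Tensor.norm_mulEight (d + 2),
      Tensor.one_div_sqrt_lt_bestRankOneRatio_symmetric (n := 8) (by norm_num)⟩
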